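/- Let $p\in\mathbb N$, $\tau>0$, $\rho>0$; write $\mathbb S^p_+$ ($\mathbb S^p_{++}$) for the real symmetric positive semidefinite (positive definite) $p\times p$ matrices, $\langle A,B\rangle=\mathrm{Tr}(A^\top B)$ and $\|A\|_F=\sqrt{\langle A,A\rangle}$. Let $\widehat\Sigma\in\mathbb S^p_+$ have the spectral decomposition $\widehat\Sigma=\widehat V\,\mathrm{diag}(\widehat\lambda)\,\widehat V^\top$ with $\widehat V$ orthogonal and $0\le\widehat\lambda_1\le\dots\le\widehat\lambda_p$. Let $D:\mathbb S^p_+\times\mathbb S^p_+\to[0,\infty]$, with domain $\mathrm{dom}(D)=\{(X,Y):D(X,Y)<\infty\}$, and $d:\mathbb R_+\times\mathbb R_+\to[0,\infty]$ satisfy the following. 1. (Regular nominal matrix) $(\widehat\Sigma,\widehat\Sigma)\in\mathrm{dom}(D)$. 2. (Convex divergence) For $(X,Y)\in\mathrm{dom}(D)$, $D(X,Y)=0$ if and only if $X=Y$. The function $D(\cdot,\widehat\Sigma)$ is convex and continuous on $\mathbb S^p_+$ (as a function into $[0,\infty]$), differentiable in the interior of its domain, and coercive: $D(X,\widehat\Sigma)\to\infty$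 as $\|X\|_F\to\infty$. 3. (Spectral divergence with generator $d$) (i) $D(X,Y)=D(VXV^\top,VYV^\top)$ for all $X,Y\in\mathbb S^p_+$ and orthogonal $V$. (ii) $D(\mathrm{diag}(x),\mathrm{diag}(y))=\sum_{i=1}^p d(x_i,y_i)$ for all $x,y\in\mathbb R^p_+$, and for every $b\ge0$ with $d(b,b)<\infty$ the function $d(\cdot,b)$ is finite and twice continuously differentiable on $(0,\infty)$. (iii) $D(V\mathrm{diag}(x)V^\top,\mathrm{diag}(y))\ge D(\mathrm{diag}(x),\mathrm{diag}(y))$ for all $x,y\in\mathbb R^p_+$ with non-decreasing entries and all orthogonal $V$. 4. $\widehat\Sigma\ne\sigma I$ for every $\sigma>0$. 5. $0<\rho\le\rho_{\max}:=\sum_{i=1}^p d\big(\sqrt{1/\tau},\widehat\lambda_i\big)$. Consider the robust problem $$\min_{\substack{\Sigma,X\in\mathbb S^p_{++}\\ X\Sigma=I}}\ \max_{S\in\mathbb S^p_+:\,D(S,\widehat\Sigma)\le\rho}\ \Big\{-\log\det X+\langle X,S\rangle+\tfrac{\tau}{2}\big(\|\Sigma\|_F^2-2\langle\Sigma,S\rangle\big)\Big\}.\tag{RO}$$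 Then: (a) for every $\gamma\ge0$ and every $i$, with $b=\widehat\lambda_i$, the equation $\frac1a-\tau a-\gamma\frac{\partial d}{\partial a}(a,b)=0$ has exactly one solution $a>0$; call it $\varphi(\tau,\gamma,b)$; (b) the equation $\sum_{i=1}^p d(\varphi(\tau,\gamma,\widehat\lambda_i),\widehat\lambda_i)=\rho$ has exactly one root $\gamma^\star\ge0$; (c) the inner maximum in (RO) is attained at every feasible pair $(\Sigma,X)$, and (RO) has exactly one optimal solution $(\Sigma^\star,X^\star)$, namely $$\Sigma^\star=\widehat V\,\mathrm{diag}\big(\varphi(\tau,\gamma^\star,\widehat\lambda_1),\dots,\varphi(\tau,\gamma^\star,\widehat\lambda_p)\big)\,\widehat V^\top,\qquad X^\star=(\Sigma^\star)^{-1}.$$ -/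

import Mathlib

open Matrix Filter Topology
open scoped ENNReal

/-- The trace inner product `⟨A, B⟩ = Tr(Aᵀ B)`. -/
noncomputable def frobInner {p : ℕ} (A B : Matrix (Fin p) (Fin p) ℝ) : ℝ := (Aᵀ * B).trace

/-- The Frobenius norm `‖A‖_F = √⟨A, A⟩`. -/
noncomputable def frobNorm {p : ℕ} (A : Matrix (Fin p) (Fin p) ℝ) : ℝ := √(frobInner A A)

/-- The cone of positive semidefinite matrices. -/
def psdCone (p : ℕ) : Set (Matrix (Fin p) (Fin p) ℝ) := {S | S.PosSemidef}

/-- Convex divergence with respect to the nominal matrix `Sn`. A divergence is an extended-valued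
function `D : 𝕊₊ × 𝕊₊ → [0, ∞]`, with domain `{(X, Y) | D X Y ≠ ∞}`; its values outside the
positive semidefinite cone are never used. -/
structure IsConvexDivergence {p : ℕ}
    (D : Matrix (Fin p) (Fin p) ℝ → Matrix (Fin p) (Fin p) ℝ → ℝ≥0∞)
    (Sn : Matrix (Fin p) (Fin p) ℝ) : Prop where
  /-- identity of indiscernibles on the domain -/
  eq_zero_iff : ∀ X Y : Matrix (Fin p) (Fin p) ℝ, X.PosSemidef → Y.PosSemidef →
    D X Y ≠ ⊤ → (D X Y = 0 ↔ X = Y)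
  /-- `D(·, Sn)` is convex on the positive semidefinite cone -/
  convex : ∀ X Y : Matrix (Fin p) (Fin p) ℝ, X.PosSemidef → Y.PosSemidef →
    ∀ s t : ℝ, 0 ≤ s → 0 ≤ t → s + t = 1 →
      D (s • X + t • Y) Sn ≤ ENNReal.ofReal s * D X Sn + ENNReal.ofReal t * D Y Sn
  /-- `D(·, Sn)` is continuous on the positive semidefinite cone, as a map into `[0, ∞]` -/
  continuousOn : ContinuousOn (fun X => D X Sn) (psdCone p)
  /-- `D(·, Sn)` is differentiable, as a function of a symmetric matrix, in the interior of its
  domain (the positive definite matrices at which it is finite) -/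
  differentiable : ∀ X : Matrix (Fin p) (Fin p) ℝ, X.PosDef → D X Sn ≠ ⊤ →
    DifferentiableWithinAt ℝ (fun Z => (D Z Sn).toReal) (psdCone p) X
  /-- `D(·, Sn)` is coercive -/
  coercive : Tendsto (fun X => D X Sn) (comap frobNorm atTop ⊓ 𝓟 (psdCone p)) (𝓝 ⊤)

/-- Spectral divergence with generator `d : ℝ₊ × ℝ₊ → [0, ∞]`. -/
structure IsSpectralDivergence {p : ℕ}
    (D : Matrix (Fin p) (Fin p) ℝ → Matrix (Fin p) (Fin p) ℝ → ℝ≥0∞)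
    (d : ℝ → ℝ → ℝ≥0∞) : Prop where
  /-- orthogonal equivariance -/
  equivariant : ∀ X Y V : Matrix (Fin p) (Fin p) ℝ, X.PosSemidef → Y.PosSemidef →
    V ∈ orthogonalGroup (Fin p) ℝ → D X Y = D (V * X * Vᵀ) (V * Y * Vᵀ)
  /-- spectrality -/
  spectral : ∀ x y : Fin p → ℝ, (∀ i, 0 ≤ x i) → (∀ i, 0 ≤ y i) →
    D (diagonal x) (diagonal y) = ∑ i, d (x i) (y i)
  /-- for every admissible `b ≥ 0`, `d(·, b)` is finite on `(0, ∞)` … -/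
  finite : ∀ b : ℝ, 0 ≤ b → d b b ≠ ⊤ → ∀ a : ℝ, 0 < a → d a b ≠ ⊤
  /-- … and twice continuously differentiable there -/
  contDiffOn : ∀ b : ℝ, 0 ≤ b → d b b ≠ ⊤ →
    ContDiffOn ℝ 2 (fun a => (d a b).toReal) (Set.Ioi 0)
  /-- rearrangement property, for vectors with entries in non-decreasing order -/
  rearrangement : ∀ (x y : Fin p → ℝ) (V : Matrix (Fin p) (Fin p) ℝ),
    (∀ i, 0 ≤ x i) → (∀ i, 0 ≤ y i) → Monotone x → Monotone y →
    V ∈ orthogonalGroup (Fin p) ℝ →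
      D (diagonal x) (diagonal y) ≤ D (V * diagonal x * Vᵀ) (diagonal y)

/-- `a` is a positive solution of `1/a - τ a - γ ∂d/∂a (a, b) = 0`. -/
def IsEigenRoot (d : ℝ → ℝ → ℝ≥0∞) (τ γ b a : ℝ) : Prop :=
  0 < a ∧ 1 / a - τ * a - γ * deriv (fun u => (d u b).toReal) a = 0

open Classical in
/-- The eigenvalue mapping `φ(τ, γ, b)`: the positive solution of
`1/a - τ a - γ ∂d/∂a (a, b) = 0` (the value is `0` if there is none). -/
noncomputable def eigenMap (d : ℝ → ℝ → ℝ≥0∞) (τ γ b : ℝ) : ℝ :=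
  if h : ∃ a, IsEigenRoot d τ γ b a then h.choose else 0

/-- The uncertainty set `{S ∈ 𝕊₊ | D(S, Sn) ≤ ρ}`. -/
def uncertaintySet {p : ℕ}
    (D : Matrix (Fin p) (Fin p) ℝ → Matrix (Fin p) (Fin p) ℝ → ℝ≥0∞)
    (Sn : Matrix (Fin p) (Fin p) ℝ) (ρ : ℝ) : Set (Matrix (Fin p) (Fin p) ℝ) :=
  {S | S.PosSemidef ∧ D S Sn ≤ ENNReal.ofReal ρ}

/-- The objective
`f(Sg, X, S) = -log det X + ⟨X, S⟩ + (τ/2) (‖Sg‖_F² - 2 ⟨Sg, S⟩)`. -/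
noncomputable def roObjective {p : ℕ} (τ : ℝ) (Sg X S : Matrix (Fin p) (Fin p) ℝ) : ℝ :=
  -Real.log X.det + frobInner X S + 1 / 2 * τ * (frobNorm Sg ^ 2 - 2 * frobInner Sg S)

/-- The feasible pairs: positive definite and inverse to each other. -/
def RoFeasible {p : ℕ} (Sg X : Matrix (Fin p) (Fin p) ℝ) : Prop :=
  Sg.PosDef ∧ X.PosDef ∧ X * Sg = 1

/-- The worst-case objective value of the pair `(Sg, X)`, a supremum in `[-∞, ∞]`. -/
noncomputable def roWorstCase {p : ℕ}
    (D : Matrix (Fin p) (Fin p) ℝ → Matrix (Fin p) (Fin p) ℝ → ℝ≥0∞)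
    (Sn : Matrix (Fin p) (Fin p) ℝ) (τ ρ : ℝ) (Sg X : Matrix (Fin p) (Fin p) ℝ) : EReal :=
  ⨆ S ∈ uncertaintySet D Sn ρ, ((roObjective τ Sg X S : ℝ) : EReal)

/-- `(Sg, X)` is an optimal solution of the min-max problem (RO). -/
def IsRoSolution {p : ℕ}
    (D : Matrix (Fin p) (Fin p) ℝ → Matrix (Fin p) (Fin p) ℝ → ℝ≥0∞)
    (Sn : Matrix (Fin p) (Fin p) ℝ) (τ ρ : ℝ) (Sg X : Matrix (Fin p) (Fin p) ℝ) : Prop :=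
  RoFeasible Sg X ∧ ∀ Sg' X' : Matrix (Fin p) (Fin p) ℝ, RoFeasible Sg' X' →
    roWorstCase D Sn τ ρ Sg X ≤ roWorstCase D Sn τ ρ Sg' X'

/-! The proof exhibits a saddle point instead of invoking a minimax theorem. Put `A = V diag(φ) Vᵀ`.
With `S = A` fixed, the inequality `log det X + log det A ≤ ⟨X, A⟩ - p` and completion of the square
show that the objective at any feasible pair exceeds its value at `(A, A⁻¹)` by at least `(τ/2)‖Sg -
A‖²` (`roObjective_inv_add_le`). If conversely `A` is a worst case for `(A, A⁻¹)`, both optimality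
and uniqueness follow (`isRoSolution_of_isMaxOn`).

For that pair the objective is affine in `S` with gradient `A⁻¹ - τ A`. The eigenvalue equation says
that this gradient is `γ V diag(∂d/∂a) Vᵀ`, the KKT condition with multiplier `γ`. Passing to the
eigenbasis and averaging over sign flips reduces a competitor to its diagonal, where convexity of
the generators finishes the argument (`isMaxOn_conj_diagonal`).

The multiplier is found by one-dimensional analysis. Each eigenvalue root exists, is unique and
depends continuously on `γ`; the total divergence along the roots strictly decreases from `ρ_max`
and is eventually at most `ρ`, so it equals `ρ` exactly once. -/

/-! ### Scalar generators and the eigenvalue equation. -/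

/-- The properties of a real generator `f = d(·, b)` on the positive half-line: it is convex and
continuously differentiable, positive away from `b`, and it at least halves when its argument is
moved half-way towards `b`. -/
structure IsScalarGenerator (f : ℝ → ℝ) (b : ℝ) : Prop where
  nonneg_base : 0 ≤ b
  convexOn : ConvexOn ℝ (Set.Ioi 0) f
  contDiffOn : ContDiffOn ℝ 1 f (Set.Ioi 0)
  -- The base `b` may be `0`, outside the open half-line on which `f` is convex and smooth; this
  -- encodes convexity up to `b` together with `f b = 0`.
  midpoint_le : ∀ a, 0 < a → f ((a + b) / 2) ≤ f a / 2
  nonneg : ∀ a, 0 ≤ f a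
  eq_base : ∀ a, 0 < a → f a = 0 → a = b

namespace IsScalarGenerator

variable {f : ℝ → ℝ} {b : ℝ}

theorem hasDerivAt (hf : IsScalarGenerator f b) {a : ℝ} (ha : 0 < a) :
    HasDerivAt f (deriv f a) a :=
  ((hf.contDiffOn.contDiffAt (Ioi_mem_nhds ha)).differentiableAt one_ne_zero).hasDerivAt

theorem tangent_le (hf : IsScalarGenerator f b) {a c : ℝ} (ha : 0 < a) (hc : 0 < c) :
    f a + deriv f a * (c - a) ≤ f c := by
  rcases lt_trichotomy a c with h | rfl | h
  · have := hf.convexOn.le_slope_of_hasDerivAt ha hc h (hf.hasDerivAt ha)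
    rw [slope_def_field, le_div_iff₀ (by linarith)] at this
    linarith
  · simp
  · have := hf.convexOn.slope_le_of_hasDerivAt hc ha h (hf.hasDerivAt ha)
    rw [slope_def_field, div_le_iff₀ (by linarith)] at this
    linarith

theorem deriv_sub_mul_nonneg (hf : IsScalarGenerator f b) {a c : ℝ} (ha : 0 < a) (hc : 0 < c) :
    0 ≤ (deriv f a - deriv f c) * (a - c) := by
  have h1 := hf.tangent_le ha hc
  have h2 := hf.tangent_le hc ha
  linarith

/-- This is the tangent inequality at `a` tested against `b`, where `f` vanishes. Testing at the
midpoint of `a` and `b` keeps the argument positive even if `b = 0`. -/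
theorem le_deriv_mul (hf : IsScalarGenerator f b) {a : ℝ} (ha : 0 < a) :
    f a ≤ deriv f a * (a - b) := by
  have h1 := hf.tangent_le ha (c := (a + b) / 2) (by linarith [hf.nonneg_base])
  have h2 := hf.midpoint_le a ha
  linarith

theorem continuousOn_deriv (hf : IsScalarGenerator f b) : ContinuousOn (deriv f) (Set.Ioi 0) :=
  hf.contDiffOn.continuousOn_deriv_of_isOpen isOpen_Ioi le_rfl

theorem balance_strictAntiOn (hf : IsScalarGenerator f b) {τ γ : ℝ} (hτ : 0 < τ) (hγ : 0 ≤ γ) :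
    StrictAntiOn (fun a => 1 / a - τ * a - γ * deriv f a) (Set.Ioi 0) := by
  intro a ha c hc hac
  have ha' : 0 < a := ha
  have h1 : 1 / c < 1 / a := one_div_lt_one_div_of_lt ha hac
  have h2 : deriv f a ≤ deriv f c := by
    have := hf.deriv_sub_mul_nonneg (show 0 < c from hc) ha'
    nlinarith
  have h3 := mul_le_mul_of_nonneg_left h2 hγ
  have h4 := mul_lt_mul_of_pos_left hac hτ
  simp only
  linarith

theorem existsUnique_root (hf : IsScalarGenerator f b) {τ γ : ℝ} (hτ : 0 < τ) (hγ : 0 ≤ γ) :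
    ∃! a : ℝ, 0 < a ∧ 1 / a - τ * a - γ * deriv f a = 0 := by
  have hanti := hf.balance_strictAntiOn hτ hγ
  have hcont : ContinuousOn (fun a => 1 / a - τ * a - γ * deriv f a) (Set.Ioi 0) := by
    have := hf.continuousOn_deriv
    have h0 : ∀ x ∈ Set.Ioi (0 : ℝ), x ≠ 0 := fun x hx => (ne_of_gt hx)
    fun_prop (disch := assumption)
  set m := deriv f 1 with hm
  have hmono : ∀ a c : ℝ, 0 < a → a ≤ c → deriv f a ≤ deriv f c := by
    intro a c ha hac
    rcases hac.eq_or_lt with rfl | h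
    · exact le_rfl
    · have := hf.deriv_sub_mul_nonneg (ha.trans h) ha
      nlinarith
  have hK : 0 ≤ γ * |m| := by positivity
  have hle : γ * m ≤ γ * |m| := mul_le_mul_of_nonneg_left (le_abs_self m) hγ
  have hge : -(γ * |m|) ≤ γ * m := by
    have := mul_le_mul_of_nonneg_left (neg_abs_le m) hγ
    linarith
  -- Both endpoints come from comparing `deriv f` with its value `m` at `1`: `1 / a₀` outweighs the
  -- other terms to the left of `1`, and `τ * a₁` outweighs them to the right.
  set a₀ := 1 / (1 + τ + γ * |m|) with ha₀
  have hden : 1 ≤ 1 + τ + γ * |m| := by linarith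
  have ha₀pos : 0 < a₀ := by positivity
  have ha₀le : a₀ ≤ 1 := by
    rw [ha₀, div_le_one (by linarith)]; exact hden
  set a₁ := 1 + (1 + γ * |m|) / τ with ha₁
  have ha₁ge : 1 ≤ a₁ := by
    have : 0 ≤ (1 + γ * |m|) / τ := by positivity
    linarith
  have h0 : 0 ≤ 1 / a₀ - τ * a₀ - γ * deriv f a₀ := by
    have h1 : 1 / a₀ = 1 + τ + γ * |m| := by rw [ha₀, one_div_one_div]
    have h2 := mul_le_mul_of_nonneg_left (hmono a₀ 1 ha₀pos ha₀le) hγ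
    have h3 := mul_le_mul_of_nonneg_left ha₀le hτ.le
    rw [h1]; linarith
  have h1 : 1 / a₁ - τ * a₁ - γ * deriv f a₁ ≤ 0 := by
    have h1 : 1 / a₁ ≤ 1 := by rw [div_le_one (by linarith)]; exact ha₁ge
    have h2 := mul_le_mul_of_nonneg_left (hmono 1 a₁ one_pos ha₁ge) hγ
    have h3 : τ * a₁ = τ + (1 + γ * |m|) := by rw [ha₁]; field_simp
    linarith
  have hsub : Set.Icc a₀ a₁ ⊆ Set.Ioi 0 := fun x hx => lt_of_lt_of_le ha₀pos hx.1
  obtain ⟨a, ha, hroot⟩ := intermediate_value_Icc' (ha₀le.trans ha₁ge) (hcont.mono hsub) ⟨h1, h0⟩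
  refine ⟨a, ⟨hsub ha, hroot⟩, fun c hc => ?_⟩
  exact hanti.injOn hc.1 (hsub ha) (hc.2.trans hroot.symm)

variable {τ : ℝ} {r : ℝ → ℝ}

/-- Multiplying the root equation by `a - b` turns `le_deriv_mul` into a bound on `γ * f a`, and `τ
* a * b - τ * a ^ 2 ≤ τ * b ^ 2 / 4`. The resulting `O(1/γ)` decay pushes the total divergence below
any `ρ > 0`. -/
theorem le_of_root (hf : IsScalarGenerator f b) {γ a : ℝ} (hτ : 0 < τ) (hγ : 0 < γ) (ha : 0 < a)
    (hroot : 1 / a - τ * a - γ * deriv f a = 0) : f a ≤ (1 + τ * b ^ 2 / 4) / γ := by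
  rw [le_div_iff₀ hγ]
  have h1 := mul_le_mul_of_nonneg_left (hf.le_deriv_mul ha) hγ.le
  have h2 : γ * (deriv f a * (a - b)) = 1 - τ * a ^ 2 - b / a + τ * a * b := by
    have : γ * deriv f a = 1 / a - τ * a := by linarith
    rw [← mul_assoc, this]; field_simp; ring
  have h3 : 0 ≤ b / a := div_nonneg hf.nonneg_base ha.le
  nlinarith [mul_nonneg hτ.le (sq_nonneg (a - b / 2))]

/-- Subtract the two equations and multiply by `a₁ - a₂`: the reciprocal term and the `γ₁` term have
a sign by monotonicity, and the remaining `(γ₂ - γ₁) * deriv f a₂` term is bounded by the tangent at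
`a₂`. This replaces implicit differentiation in `γ`. -/
theorem root_comparison (hf : IsScalarGenerator f b) {γ₁ γ₂ a₁ a₂ : ℝ} (hγ₁ : 0 ≤ γ₁)
    (h : γ₁ < γ₂) (ha₁ : 0 < a₁) (ha₂ : 0 < a₂)
    (h₁ : 1 / a₁ - τ * a₁ - γ₁ * deriv f a₁ = 0) (h₂ : 1 / a₂ - τ * a₂ - γ₂ * deriv f a₂ = 0) :
    τ * (a₁ - a₂) ^ 2 ≤ (γ₂ - γ₁) * (f a₁ - f a₂) := by
  have hm := mul_nonneg hγ₁ (hf.deriv_sub_mul_nonneg ha₁ ha₂)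
  have ht := mul_le_mul_of_nonneg_left (hf.tangent_le ha₂ ha₁) (sub_pos.2 h).le
  have hinv : (1 / a₁ - 1 / a₂) * (a₁ - a₂) ≤ 0 := by
    have : (1 / a₁ - 1 / a₂) * (a₁ - a₂) = -((a₁ - a₂) ^ 2 / (a₁ * a₂)) := by
      field_simp; ring
    rw [this, neg_nonpos]; positivity
  have e : 1 / a₁ - 1 / a₂ = τ * (a₁ - a₂) + (γ₁ * deriv f a₁ - γ₂ * deriv f a₂) := by linarith
  rw [e] at hinv
  nlinarith

theorem generator_root_le (hf : IsScalarGenerator f b) (hτ : 0 < τ) {γ₁ γ₂ a₁ a₂ : ℝ}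
    (hγ₁ : 0 ≤ γ₁) (h : γ₁ < γ₂) (ha₁ : 0 < a₁) (ha₂ : 0 < a₂)
    (h₁ : 1 / a₁ - τ * a₁ - γ₁ * deriv f a₁ = 0) (h₂ : 1 / a₂ - τ * a₂ - γ₂ * deriv f a₂ = 0) :
    f a₂ ≤ f a₁ := by
  have h3 := hf.root_comparison hγ₁ h ha₁ ha₂ h₁ h₂
  have h4 : 0 ≤ τ * (a₁ - a₂) ^ 2 := by positivity
  exact sub_nonneg.1 (nonneg_of_mul_nonneg_right (h4.trans h3) (sub_pos.2 h))

theorem generator_root_lt (hf : IsScalarGenerator f b) (hτ : 0 < τ) (hb : b ≠ √(1 / τ))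
    {γ₁ γ₂ a₁ a₂ : ℝ} (hγ₁ : 0 ≤ γ₁) (h : γ₁ < γ₂) (ha₁ : 0 < a₁) (ha₂ : 0 < a₂)
    (h₁ : 1 / a₁ - τ * a₁ - γ₁ * deriv f a₁ = 0) (h₂ : 1 / a₂ - τ * a₂ - γ₂ * deriv f a₂ = 0) :
    f a₂ < f a₁ := by
  have h3 := hf.root_comparison hγ₁ h ha₁ ha₂ h₁ h₂
  have hne : a₁ ≠ a₂ := by
    -- A common root for two multipliers is a critical point of `f`, hence equals `b`; the equation
    -- then reduces to `1 / b = τ * b`, the excluded case.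
    rintro rfl
    have hd : deriv f a₁ = 0 := by
      have : (γ₂ - γ₁) * deriv f a₁ = 0 := by linarith
      exact (mul_eq_zero.1 this).resolve_left (sub_pos.2 h).ne'
    have h0 := hf.le_deriv_mul ha₁
    rw [hd, zero_mul] at h0
    have hab := hf.eq_base a₁ ha₁ (le_antisymm h0 (hf.nonneg _))
    rw [hd, mul_zero, sub_zero] at h₁
    apply hb
    rw [← hab, eq_comm, Real.sqrt_eq_iff_mul_self_eq (by positivity) ha₁.le]
    field_simp at h₁ ⊢
    linarith
  have h4 : 0 < τ * (a₁ - a₂) ^ 2 := by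
    have := sub_ne_zero.2 hne
    positivity
  exact sub_pos.1 (pos_of_mul_pos_right (h4.trans_le h3) (sub_pos.2 h).le)

/-- At a fixed test point on either side of `r γ₀` the balance has a strict sign, which persists for
nearby `γ` and keeps `r γ` on the same side of that point. -/
theorem continuousOn_root (hf : IsScalarGenerator f b) (hτ : 0 < τ)
    (hr : ∀ γ, 0 ≤ γ → 0 < r γ ∧ 1 / r γ - τ * r γ - γ * deriv f (r γ) = 0) :
    ContinuousOn r (Set.Ici 0) := by
  intro γ₀ hγ₀
  have key : ∀ a, 0 < a → ContinuousWithinAt (fun γ => 1 / a - τ * a - γ * deriv f a)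
      (Set.Ici 0) γ₀ := fun a _ => by fun_prop
  obtain ⟨hpos, hroot⟩ := hr γ₀ hγ₀
  refine tendsto_order.2 ⟨fun l hl => ?_, fun u hu => ?_⟩
  · have hl' : max l (r γ₀ / 2) < r γ₀ := max_lt hl (by linarith)
    have hm : 0 < max l (r γ₀ / 2) := lt_max_of_lt_right (by linarith)
    have h1 := hf.balance_strictAntiOn hτ hγ₀ hm hpos hl'
    simp only [hroot] at h1
    filter_upwards [(key _ hm).eventually (lt_mem_nhds h1), self_mem_nhdsWithin] with γ h2 hγ
    refine lt_of_le_of_lt (le_max_left l (r γ₀ / 2)) ?_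
    rw [← (hr γ hγ).2] at h2
    exact ((hf.balance_strictAntiOn hτ hγ).lt_iff_gt (hr γ hγ).1 hm).1 h2
  · have hm : 0 < u := hpos.trans hu
    have h1 := hf.balance_strictAntiOn hτ hγ₀ hpos hm hu
    simp only [hroot] at h1
    filter_upwards [(key _ hm).eventually (gt_mem_nhds h1), self_mem_nhdsWithin] with γ h2 hγ
    rw [← (hr γ hγ).2] at h2
    exact ((hf.balance_strictAntiOn hτ hγ).lt_iff_gt hm (hr γ hγ).1).1 h2

theorem root_zero {a : ℝ} (ha : 0 < a) (hτ : 0 < τ)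
    (hroot : 1 / a - τ * a - 0 * deriv f a = 0) : a = √(1 / τ) := by
  rw [eq_comm, Real.sqrt_eq_iff_mul_self_eq (by positivity) ha.le]
  field_simp at hroot ⊢
  linarith

end IsScalarGenerator

/-! ### Existence and uniqueness of the multiplier. -/

/-- The total generator along the eigenvalue roots takes every positive value up to its value at
`0` exactly once. -/
theorem exists_sum_generator_eq {ι : Type*} [Fintype ι] {f : ι → ℝ → ℝ} {b : ι → ℝ} {r : ι → ℝ → ℝ}
    {τ ρ : ℝ} (hf : ∀ i, IsScalarGenerator (f i) (b i)) (hτ : 0 < τ) (hρ : 0 < ρ)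
    (hρmax : ρ ≤ ∑ i, f i √(1 / τ))
    (hr : ∀ i γ, 0 ≤ γ → 0 < r i γ ∧ 1 / r i γ - τ * r i γ - γ * deriv (f i) (r i γ) = 0) :
    ∃ γ, 0 ≤ γ ∧ ∑ i, f i (r i γ) = ρ := by
  have hcont : ContinuousOn (fun γ => ∑ i, f i (r i γ)) (Set.Ici 0) :=
    continuousOn_finsetSum _ fun i _ =>
      (hf i).contDiffOn.continuousOn.comp ((hf i).continuousOn_root hτ (hr i))
        fun γ hγ => (hr i γ hγ).1
  have h0 : ∑ i, f i (r i 0) = ∑ i, f i √(1 / τ) :=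
    Finset.sum_congr rfl fun i _ => by
      rw [IsScalarGenerator.root_zero (hr i 0 le_rfl).1 hτ (hr i 0 le_rfl).2]
  set C := ∑ i, (1 + τ * b i ^ 2 / 4) with hC
  have hC0 : 0 ≤ C := Finset.sum_nonneg fun i _ => by positivity
  -- Any positive `Γ ≥ C / ρ` makes the bound `C / Γ` from `le_of_root` at most `ρ`.
  set Γ := C / ρ + 1 with hΓ
  have hΓ0 : 0 < Γ := by positivity
  have h1 : ∑ i, f i (r i Γ) ≤ ρ := by
    calc ∑ i, f i (r i Γ) ≤ ∑ i, (1 + τ * b i ^ 2 / 4) / Γ :=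
          Finset.sum_le_sum fun i _ =>
            (hf i).le_of_root hτ hΓ0 (hr i Γ hΓ0.le).1 (hr i Γ hΓ0.le).2
      _ = C / Γ := by rw [← Finset.sum_div]
      _ ≤ ρ := by
        rw [div_le_iff₀ hΓ0, hΓ, mul_add, mul_div_cancel₀ _ hρ.ne']
        linarith
  obtain ⟨γ, hγ, e⟩ := intermediate_value_Icc' hΓ0.le (hcont.mono fun x hx => hx.1)
    ⟨h1, hρmax.trans_eq h0.symm⟩
  exact ⟨γ, hγ.1, e⟩

theorem sum_generator_injective {ι : Type*} [Fintype ι] {f : ι → ℝ → ℝ} {b : ι → ℝ}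
    {r : ι → ℝ → ℝ} {τ : ℝ} (hf : ∀ i, IsScalarGenerator (f i) (b i)) (hτ : 0 < τ)
    (hb : ∃ i, b i ≠ √(1 / τ))
    (hr : ∀ i γ, 0 ≤ γ → 0 < r i γ ∧ 1 / r i γ - τ * r i γ - γ * deriv (f i) (r i γ) = 0) :
    Set.InjOn (fun γ => ∑ i, f i (r i γ)) (Set.Ici 0) := by
  refine StrictAntiOn.injOn fun γ₁ h₁ γ₂ h₂ h => ?_
  obtain ⟨j, hj⟩ := hb
  exact Finset.sum_lt_sum
    (fun i _ => (hf i).generator_root_le hτ h₁ h (hr i γ₁ h₁).1 (hr i γ₂ h₂).1 (hr i γ₁ h₁).2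
      (hr i γ₂ h₂).2)
    ⟨j, Finset.mem_univ j, (hf j).generator_root_lt hτ hj h₁ h (hr j γ₁ h₁).1 (hr j γ₂ h₂).1
      (hr j γ₁ h₁).2 (hr j γ₂ h₂).2⟩

/-! ### The trace inner product. -/

section FrobeniusInner

variable {p : ℕ}

theorem frobInner_comm (A B : Matrix (Fin p) (Fin p) ℝ) : frobInner A B = frobInner B A := by
  unfold frobInner
  rw [← trace_transpose, transpose_mul, transpose_transpose]

theorem frobInner_self_nonneg (A : Matrix (Fin p) (Fin p) ℝ) : 0 ≤ frobInner A A := by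
  have := (posSemidef_conjTranspose_mul_self A).trace_nonneg
  rwa [conjTranspose_eq_transpose_of_trivial] at this

theorem frobInner_self_eq_zero {A : Matrix (Fin p) (Fin p) ℝ} : frobInner A A = 0 ↔ A = 0 := by
  have := trace_conjTranspose_mul_self_eq_zero_iff (A := A)
  rwa [conjTranspose_eq_transpose_of_trivial] at this

theorem frobNorm_sq (A : Matrix (Fin p) (Fin p) ℝ) : frobNorm A ^ 2 = frobInner A A :=
  Real.sq_sqrt (frobInner_self_nonneg A)

theorem frobInner_sub_self (A B : Matrix (Fin p) (Fin p) ℝ) :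
    frobInner (A - B) (A - B) = frobInner A A - 2 * frobInner A B + frobInner B B := by
  have h := frobInner_comm A B
  unfold frobInner at *
  simp only [transpose_sub, sub_mul, mul_sub, trace_sub]
  linarith

theorem abs_apply_le_frobNorm (A : Matrix (Fin p) (Fin p) ℝ) (i j : Fin p) :
    |A i j| ≤ frobNorm A := by
  refine Real.abs_le_sqrt ?_
  have h : frobInner A A = ∑ l, ∑ k, A k l ^ 2 := by
    simp [frobInner, trace, mul_apply, sq]
  rw [h]
  calc A i j ^ 2 ≤ ∑ k, A k j ^ 2 :=
        Finset.single_le_sum (f := fun k => A k j ^ 2) (fun k _ => sq_nonneg _) (Finset.mem_univ i)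
    _ ≤ _ := Finset.single_le_sum (f := fun l => ∑ k, A k l ^ 2)
        (fun l _ => Finset.sum_nonneg fun k _ => sq_nonneg _) (Finset.mem_univ j)

theorem continuous_frobInner (X : Matrix (Fin p) (Fin p) ℝ) :
    Continuous fun S => frobInner X S :=
  (continuous_const.matrix_mul continuous_id).matrix_trace

theorem frobInner_conj_diagonal (V S : Matrix (Fin p) (Fin p) ℝ) (m : Fin p → ℝ) :
    frobInner (V * diagonal m * Vᵀ) S = ∑ i, m i * (Vᵀ * S * V) i i := by
  have h : frobInner (V * diagonal m * Vᵀ) S = (diagonal m * (Vᵀ * S * V)).trace := by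
    unfold frobInner
    rw [transpose_mul, transpose_mul, transpose_transpose, diagonal_transpose, Matrix.mul_assoc,
      trace_mul_comm]
    simp only [Matrix.mul_assoc]
  rw [h]
  simp [trace, diagonal_mul]

end FrobeniusInner

/-! ### Positive matrices, the log-determinant inequality and sign-flip averaging. -/

section PositiveMatrices

variable {p : ℕ}

theorem isClosed_psdCone : IsClosed (psdCone p) := by
  have h : psdCone p = {S | Sᵀ = S} ∩ ⋂ x : Fin p → ℝ, {S | 0 ≤ x ⬝ᵥ (S *ᵥ x)} := by
    ext S
    simp [psdCone, posSemidef_iff_dotProduct_mulVec, IsHermitian,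
      conjTranspose_eq_transpose_of_trivial]
  rw [h]
  refine (isClosed_eq continuous_id.matrix_transpose continuous_id).inter
    (isClosed_iInter fun x => isClosed_le continuous_const ?_)
  exact Continuous.dotProduct continuous_const (continuous_id.matrix_mulVec continuous_const)

theorem posSemidef_conj {S : Matrix (Fin p) (Fin p) ℝ} (hS : S.PosSemidef)
    (W : Matrix (Fin p) (Fin p) ℝ) : (W * S * Wᵀ).PosSemidef := by
  simpa [conjTranspose_eq_transpose_of_trivial] using hS.mul_mul_conjTranspose_same W

theorem posSemidef_combination {X Y : Matrix (Fin p) (Fin p) ℝ} (hX : X.PosSemidef)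
    (hY : Y.PosSemidef) {s t : ℝ} (hs : 0 ≤ s) (ht : 0 ≤ t) : (s • X + t • Y).PosSemidef :=
  (hX.smul hs).add (hY.smul ht)

theorem log_det_le_trace_sub_card {M : Matrix (Fin p) (Fin p) ℝ} (hM : M.PosDef) :
    Real.log M.det ≤ M.trace - p := by
  have hpos := hM.eigenvalues_pos
  rw [hM.1.det_eq_prod_eigenvalues, hM.1.trace_eq_sum_eigenvalues]
  simp only [RCLike.ofReal_real_eq_id, id_eq]
  rw [Real.log_prod fun i _ => (hpos i).ne']
  calc ∑ i, Real.log (hM.1.eigenvalues i) ≤ ∑ i, (hM.1.eigenvalues i - 1) :=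
        Finset.sum_le_sum fun i _ => Real.log_le_sub_one_of_pos (hpos i)
    _ = _ := by simp

open scoped MatrixOrder in
-- The product `X * S` need not be symmetric. With `X = Bᵀ * B`, the matrix `B * S * Bᵀ` is positive
-- definite and has the same trace and determinant, so `log x ≤ x - 1` can be applied to its
-- eigenvalues.
theorem log_det_add_log_det_le {X S : Matrix (Fin p) (Fin p) ℝ} (hX : X.PosDef) (hS : S.PosDef) :
    Real.log X.det + Real.log S.det ≤ frobInner X S - p := by
  obtain ⟨B, hB⟩ := CStarAlgebra.nonneg_iff_eq_star_mul_self.1 hX.posSemidef.nonneg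
  rw [star_eq_conjTranspose, conjTranspose_eq_transpose_of_trivial] at hB
  have hdetX : X.det = B.det * B.det := by rw [hB, det_mul, det_transpose]
  have hdet : (B * S * Bᵀ).det = X.det * S.det := by
    rw [det_mul, det_mul, det_transpose, hdetX]; ring
  have hM : (B * S * Bᵀ).PosDef := by
    rw [(posSemidef_conj hS.posSemidef B).posDef_iff_isUnit, isUnit_iff_isUnit_det, hdet]
    exact (mul_pos hX.det_pos hS.det_pos).ne'.isUnit
  have htr : (B * S * Bᵀ).trace = frobInner X S := by
    have hXt : Xᵀ = X := by
      rw [← conjTranspose_eq_transpose_of_trivial]; exact hX.1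
    rw [frobInner, hXt, hB, Matrix.mul_assoc, trace_mul_comm, Matrix.mul_assoc, trace_mul_comm]
  rw [← Real.log_mul hX.det_pos.ne' hS.det_pos.ne', ← hdet, ← htr]
  exact log_det_le_trace_sub_card hM

/-- The reflection that flips the sign of the `k`-th coordinate. -/
def signFlip (k : Fin p) : Matrix (Fin p) (Fin p) ℝ := diagonal fun i => if i = k then -1 else 1

theorem signFlip_conj_apply (k : Fin p) (S : Matrix (Fin p) (Fin p) ℝ) (i j : Fin p) :
    (signFlip k * S * (signFlip k)ᵀ) i j =
      (if i = k then -1 else 1) * S i j * (if j = k then -1 else 1) := by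
  simp only [signFlip, diagonal_transpose, mul_diagonal, diagonal_mul]

theorem signFlip_mem_orthogonalGroup (k : Fin p) : signFlip k ∈ orthogonalGroup (Fin p) ℝ := by
  rw [mem_orthogonalGroup_iff, signFlip, diagonal_transpose, diagonal_mul_diagonal, ← diagonal_one]
  congr 1
  ext i
  split_ifs <;> simp

/-- The diagonal of a matrix is reached from it by averaging over sign flips, so that passing to
the diagonal does not increase a convex function invariant under sign flips. -/
theorem diagonal_diag_le_of_signFlip_invariant {Φ : Matrix (Fin p) (Fin p) ℝ → ℝ≥0∞} {c : ℝ≥0∞}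
    (hconv : ∀ X Y, X.PosSemidef → Y.PosSemidef → Φ X ≤ c → Φ Y ≤ c →
      Φ ((1 / 2 : ℝ) • X + (1 / 2 : ℝ) • Y) ≤ c)
    (hinv : ∀ X k, X.PosSemidef → Φ (signFlip k * X * (signFlip k)ᵀ) = Φ X)
    {S : Matrix (Fin p) (Fin p) ℝ} (hS : S.PosSemidef) (hc : Φ S ≤ c) :
    Φ (diagonal fun i => S i i) ≤ c := by
  -- Averaging `R` with its `k`-th flip clears the off-diagonal entries of row and column `k`, keeps
  -- the diagonal, and preserves the zeros already produced.
  have key : ∀ T : Finset (Fin p), ∃ R : Matrix (Fin p) (Fin p) ℝ, R.PosSemidef ∧ Φ R ≤ c ∧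
      (∀ i, R i i = S i i) ∧ ∀ i j, i ≠ j → i ∈ T → R i j = 0 := by
    intro T
    induction T using Finset.induction_on with
    | empty => exact ⟨S, hS, hc, fun _ => rfl, by simp⟩
    | insert k T _ ih =>
      obtain ⟨R, hR, hRc, hdiag, hoff⟩ := ih
      refine ⟨(1 / 2 : ℝ) • R + (1 / 2 : ℝ) • (signFlip k * R * (signFlip k)ᵀ),
        posSemidef_combination hR (posSemidef_conj hR _) (by norm_num) (by norm_num),
        hconv _ _ hR (posSemidef_conj hR _) hRc ((hinv R k hR).trans_le hRc), fun i => ?_,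
        fun i j hij hi => ?_⟩
      · rw [Matrix.add_apply, Matrix.smul_apply, Matrix.smul_apply, signFlip_conj_apply, ← hdiag i]
        simp only [smul_eq_mul]
        split_ifs <;> ring
      · rw [Matrix.add_apply, Matrix.smul_apply, Matrix.smul_apply, signFlip_conj_apply]
        simp only [smul_eq_mul]
        rcases Finset.mem_insert.1 hi with rfl | hi
        · simp [hij.symm]
        · simp [hoff i j hij hi]
  obtain ⟨R, -, hRc, hdiag, hoff⟩ := key Finset.univ
  have : (diagonal fun i => S i i) = R := by
    ext i j
    by_cases hij : i = j
    · subst hij; simp [hdiag]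
    · rw [diagonal_apply_ne _ hij, hoff i j hij (Finset.mem_univ i)]
  rwa [this]

end PositiveMatrices

/-! ### Compactness of the uncertainty set and attainment of the inner maximum. -/

section UncertaintySet

variable {p : ℕ} {D : Matrix (Fin p) (Fin p) ℝ → Matrix (Fin p) (Fin p) ℝ → ℝ≥0∞}
  {Sn : Matrix (Fin p) (Fin p) ℝ}

/-- Continuity on the closed cone gives closedness; coercivity bounds the Frobenius norm, hence
every entry. -/
theorem IsConvexDivergence.isCompact_uncertaintySet (hconv : IsConvexDivergence D Sn) (ρ : ℝ) :
    IsCompact (uncertaintySet D Sn ρ) := by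
  have hclosed : IsClosed (uncertaintySet D Sn ρ) :=
    hconv.continuousOn.preimage_isClosed_of_isClosed isClosed_psdCone isClosed_Iic
  obtain ⟨R, hR⟩ : ∃ R : ℝ, ∀ S ∈ psdCone p, R ≤ frobNorm S → ENNReal.ofReal ρ < D S Sn := by
    have h := hconv.coercive.eventually (lt_mem_nhds (ENNReal.ofReal_lt_top (r := ρ)))
    rw [eventually_inf_principal, eventually_comap, eventually_atTop] at h
    obtain ⟨R, hR⟩ := h
    exact ⟨R, fun S hS hRS => hR _ hRS S rfl hS⟩
  have hbox : IsCompact (Set.univ.pi fun _ : Fin p => Set.univ.pi fun _ : Fin p => Set.Icc (-R) R) :=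
    isCompact_univ_pi fun _ => isCompact_univ_pi fun _ => isCompact_Icc
  refine hbox.of_isClosed_subset hclosed fun S hS i _ j _ => ?_
  refine abs_le.1 ((abs_apply_le_frobNorm S i j).trans (le_of_not_ge fun h => ?_))
  exact (hR S hS.1 h).not_ge hS.2

theorem IsConvexDivergence.exists_isMaxOn_roObjective (hconv : IsConvexDivergence D Sn)
    (hSn : Sn.PosSemidef) (hreg : D Sn Sn ≠ ⊤) (τ ρ : ℝ) (Sg X : Matrix (Fin p) (Fin p) ℝ) :
    ∃ S ∈ uncertaintySet D Sn ρ, IsMaxOn (roObjective τ Sg X) (uncertaintySet D Sn ρ) S := by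
  refine (hconv.isCompact_uncertaintySet ρ).exists_isMaxOn ⟨Sn, hSn, ?_⟩ ?_
  · rw [(hconv.eq_zero_iff Sn Sn hSn hSn hreg).2 rfl]
    exact zero_le
  · unfold roObjective
    have h1 := continuous_frobInner X
    have h2 := continuous_frobInner Sg
    fun_prop

end UncertaintySet

/-! ### The saddle-point criterion. -/

section SaddlePoint

variable {p : ℕ}

theorem RoFeasible.eq_inv {Sg X : Matrix (Fin p) (Fin p) ℝ} (h : RoFeasible Sg X) : X = Sg⁻¹ :=
  (inv_eq_left_inv h.2.2).symm

/-- At a positive definite `A`, the objective exceeds its value at `(A, A⁻¹)` quadratically. -/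
theorem roObjective_inv_add_le {A Sg X : Matrix (Fin p) (Fin p) ℝ} (hA : A.PosDef)
    (hX : X.PosDef) (τ : ℝ) :
    roObjective τ A A⁻¹ A + 1 / 2 * τ * frobInner (Sg - A) (Sg - A) ≤ roObjective τ Sg X A := by
  -- The two variables decouple without the constraint `X * Sg = 1`: this inequality handles `X`,
  -- with equality at `A⁻¹`, and the square handles `Sg`.
  have h1 := log_det_add_log_det_le hX hA
  have hu : IsUnit A.det := hA.det_pos.ne'.isUnit
  have h2 : Real.log (A⁻¹).det = -Real.log A.det := by
    rw [det_nonsing_inv, Ring.inverse_eq_inv', Real.log_inv]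
  have h3 : frobInner A⁻¹ A = p := by
    have ht : (A⁻¹)ᵀ = A⁻¹ := by
      rw [← conjTranspose_eq_transpose_of_trivial]; exact hA.inv.1
    simp [frobInner, ht, nonsing_inv_mul A hu]
  unfold roObjective
  rw [frobNorm_sq, frobNorm_sq, h2, h3, frobInner_sub_self]
  linarith

/-- A matrix that is a worst case for the pair it defines gives the unique optimal solution. -/
theorem isRoSolution_of_isMaxOn {D : Matrix (Fin p) (Fin p) ℝ → Matrix (Fin p) (Fin p) ℝ → ℝ≥0∞}
    {Sn A : Matrix (Fin p) (Fin p) ℝ} {τ ρ : ℝ} (hτ : 0 < τ) (hA : A.PosDef)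
    (hmem : A ∈ uncertaintySet D Sn ρ)
    (hmax : IsMaxOn (roObjective τ A A⁻¹) (uncertaintySet D Sn ρ) A) :
    IsRoSolution D Sn τ ρ A A⁻¹ ∧
      ∀ Sg X, IsRoSolution D Sn τ ρ Sg X → Sg = A ∧ X = A⁻¹ := by
  have hfeas : RoFeasible A A⁻¹ :=
    ⟨hA, hA.inv, nonsing_inv_mul A hA.det_pos.ne'.isUnit⟩
  have hupper : roWorstCase D Sn τ ρ A A⁻¹ ≤ (roObjective τ A A⁻¹ A : ℝ) :=
    iSup₂_le fun S hS => EReal.coe_le_coe_iff.2 (hmax hS)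
  have hlower : ∀ Sg X, ((roObjective τ Sg X A : ℝ) : EReal) ≤ roWorstCase D Sn τ ρ Sg X :=
    fun Sg X => le_iSup₂_of_le (f := fun S (_ : S ∈ uncertaintySet D Sn ρ) =>
      ((roObjective τ Sg X S : ℝ) : EReal)) A hmem le_rfl
  refine ⟨⟨hfeas, fun Sg X h => hupper.trans ((EReal.coe_le_coe_iff.2 ?_).trans (hlower Sg X))⟩,
    fun Sg X h => ?_⟩
  · have h1 := roObjective_inv_add_le (Sg := Sg) hA h.2.1 τ
    have h2 := mul_nonneg hτ.le (frobInner_self_nonneg (Sg - A))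
    linarith
  · have h1 := roObjective_inv_add_le (Sg := Sg) hA h.1.2.1 τ
    -- Evaluated at `A`, an optimal pair cannot exceed the saddle value, so the quadratic gap in
    -- `h1` must vanish.
    have h2 := EReal.coe_le_coe_iff.1 ((hlower Sg X).trans ((h.2 A A⁻¹ hfeas).trans hupper))
    have h3 := frobInner_self_nonneg (Sg - A)
    have h4 : frobInner (Sg - A) (Sg - A) = 0 := by
      refine le_antisymm ?_ h3
      by_contra hcon
      have := mul_pos hτ (not_le.1 hcon)
      linarith
    have h5 : Sg = A := sub_eq_zero.1 (frobInner_self_eq_zero.1 h4)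
    exact ⟨h5, h5 ▸ h.1.eq_inv⟩

end SaddlePoint

/-! ### Spectral divergences in the eigenbasis, and the worst case. -/

section SpectralDivergence

variable {p : ℕ} {D : Matrix (Fin p) (Fin p) ℝ → Matrix (Fin p) (Fin p) ℝ → ℝ≥0∞}
  {d : ℝ → ℝ → ℝ≥0∞} {V : Matrix (Fin p) (Fin p) ℝ} {lam : Fin p → ℝ}

theorem orthogonal_transpose_mul (hV : V ∈ orthogonalGroup (Fin p) ℝ) : Vᵀ * V = 1 :=
  (mem_orthogonalGroup_iff' _ _).1 hV

theorem orthogonal_mul_transpose (hV : V ∈ orthogonalGroup (Fin p) ℝ) : V * Vᵀ = 1 :=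
  (mem_orthogonalGroup_iff _ _).1 hV

theorem orthogonal_conj_cancel (hV : V ∈ orthogonalGroup (Fin p) ℝ)
    (M : Matrix (Fin p) (Fin p) ℝ) : Vᵀ * (V * M * Vᵀ) * V = M := by
  have h := orthogonal_transpose_mul hV
  calc Vᵀ * (V * M * Vᵀ) * V = (Vᵀ * V) * M * (Vᵀ * V) := by simp only [Matrix.mul_assoc]
    _ = M := by rw [h, Matrix.one_mul, Matrix.mul_one]

theorem orthogonal_conj_cancel' (hV : V ∈ orthogonalGroup (Fin p) ℝ)
    (M : Matrix (Fin p) (Fin p) ℝ) : V * (Vᵀ * M * V) * Vᵀ = M := by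
  have h := orthogonal_mul_transpose hV
  calc V * (Vᵀ * M * V) * Vᵀ = (V * Vᵀ) * M * (V * Vᵀ) := by simp only [Matrix.mul_assoc]
    _ = M := by rw [h, Matrix.one_mul, Matrix.mul_one]

theorem posDef_conj_diagonal (hV : V ∈ orthogonalGroup (Fin p) ℝ) {x : Fin p → ℝ}
    (hx : ∀ i, 0 < x i) : (V * diagonal x * Vᵀ).PosDef := by
  have h := posSemidef_conj (PosDef.diagonal hx).posSemidef V
  refine (open scoped MatrixOrder in h.posDef_iff_isUnit).2 ?_
  have h1 : IsUnit V := IsUnit.of_mul_eq_one _ (orthogonal_mul_transpose hV)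
  have h2 : IsUnit Vᵀ := IsUnit.of_mul_eq_one _ (orthogonal_transpose_mul hV)
  exact (h1.mul (PosDef.diagonal hx).isUnit).mul h2

theorem inv_conj_diagonal (hV : V ∈ orthogonalGroup (Fin p) ℝ) {x : Fin p → ℝ}
    (hx : ∀ i, x i ≠ 0) :
    (V * diagonal x * Vᵀ)⁻¹ = V * diagonal (fun i => 1 / x i) * Vᵀ := by
  refine inv_eq_right_inv ?_
  calc V * diagonal x * Vᵀ * (V * diagonal (fun i => 1 / x i) * Vᵀ)
      = V * (diagonal x * (Vᵀ * V) * diagonal (fun i => 1 / x i)) * Vᵀ := by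
        simp only [Matrix.mul_assoc]
    _ = 1 := by
        rw [orthogonal_transpose_mul hV, Matrix.mul_one, diagonal_mul_diagonal]
        simp [hx, orthogonal_mul_transpose hV]

/-- The data of a regular divergence in an eigenbasis `V` of the nominal matrix. -/
structure IsSpectralSetting (D : Matrix (Fin p) (Fin p) ℝ → Matrix (Fin p) (Fin p) ℝ → ℝ≥0∞)
    (d : ℝ → ℝ → ℝ≥0∞) (V : Matrix (Fin p) (Fin p) ℝ) (lam : Fin p → ℝ) : Prop where
  orthogonal : V ∈ orthogonalGroup (Fin p) ℝ
  nonneg : ∀ i, 0 ≤ lam i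
  regular : D (V * diagonal lam * Vᵀ) (V * diagonal lam * Vᵀ) ≠ ⊤
  divergence : IsConvexDivergence D (V * diagonal lam * Vᵀ)
  spectral : IsSpectralDivergence D d

namespace IsSpectralSetting

variable (h : IsSpectralSetting D d V lam)
include h

theorem posSemidef_diagonal : (diagonal lam).PosSemidef := PosSemidef.diagonal h.nonneg

theorem divergence_conj {Z : Matrix (Fin p) (Fin p) ℝ} (hZ : Z.PosSemidef) :
    D Z (diagonal lam) = D (V * Z * Vᵀ) (V * diagonal lam * Vᵀ) :=
  h.spectral.equivariant Z _ V hZ h.posSemidef_diagonal h.orthogonal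

theorem convex_diagonal {X Y : Matrix (Fin p) (Fin p) ℝ} (hX : X.PosSemidef) (hY : Y.PosSemidef)
    {s t : ℝ} (hs : 0 ≤ s) (ht : 0 ≤ t) (hst : s + t = 1) :
    D (s • X + t • Y) (diagonal lam) ≤
      ENNReal.ofReal s * D X (diagonal lam) + ENNReal.ofReal t * D Y (diagonal lam) := by
  rw [h.divergence_conj hX, h.divergence_conj hY,
    h.divergence_conj (posSemidef_combination hX hY hs ht)]
  have e : V * (s • X + t • Y) * Vᵀ = s • (V * X * Vᵀ) + t • (V * Y * Vᵀ) := by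
    simp [Matrix.mul_add, Matrix.add_mul]
  rw [e]
  exact h.divergence.convex _ _ (posSemidef_conj hX V) (posSemidef_conj hY V) s t hs ht hst

theorem generator_self (i : Fin p) : d (lam i) (lam i) = 0 := by
  have h1 : D (V * diagonal lam * Vᵀ) (V * diagonal lam * Vᵀ) = 0 :=
    (h.divergence.eq_zero_iff _ _ (posSemidef_conj h.posSemidef_diagonal V)
      (posSemidef_conj h.posSemidef_diagonal V) h.regular).2 rfl
  rw [← h.divergence_conj h.posSemidef_diagonal, h.spectral.spectral lam lam h.nonneg h.nonneg,
    Finset.sum_eq_zero_iff] at h1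
  exact h1 i (Finset.mem_univ i)

theorem update_nonneg (i : Fin p) {x : ℝ} (hx : 0 ≤ x) (j : Fin p) :
    0 ≤ Function.update lam i x j := by
  rcases eq_or_ne j i with rfl | hj
  · simpa using hx
  · simpa [hj] using h.nonneg j

/-- Only one eigenvalue is moved, and the others contribute `d (lam j) (lam j) = 0`. The generator
is thus `D` along a line of diagonal matrices and inherits convexity, including at the endpoint `0`,
and its vanishing only at `lam i`. -/
theorem generator_eq (i : Fin p) {x : ℝ} (hx : 0 ≤ x) :
    d x (lam i) = D (diagonal (Function.update lam i x)) (diagonal lam) := by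
  rw [h.spectral.spectral _ _ (h.update_nonneg i hx) h.nonneg,
    Finset.sum_eq_single i _ (by simp)]
  · simp
  · intro j _ hj
    simp [hj, h.generator_self j]

theorem generator_convex (i : Fin p) {x y s t : ℝ} (hx : 0 ≤ x) (hy : 0 ≤ y) (hs : 0 ≤ s)
    (ht : 0 ≤ t) (hst : s + t = 1) :
    d (s * x + t * y) (lam i) ≤
      ENNReal.ofReal s * d x (lam i) + ENNReal.ofReal t * d y (lam i) := by
  rw [h.generator_eq i hx, h.generator_eq i hy, h.generator_eq i (by positivity)]
  have e : diagonal (Function.update lam i (s * x + t * y)) =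
      s • diagonal (Function.update lam i x) + t • diagonal (Function.update lam i y) := by
    rw [← diagonal_smul, ← diagonal_smul, diagonal_add]
    congr 1
    ext j
    rcases eq_or_ne j i with rfl | hj
    · simp
    · simp [hj, ← add_mul, hst]
  rw [e]
  exact h.convex_diagonal (PosSemidef.diagonal (h.update_nonneg i hx))
    (PosSemidef.diagonal (h.update_nonneg i hy)) hs ht hst

theorem generator_toReal_convex (i : Fin p) {x y s t : ℝ} (hx : 0 ≤ x) (hy : 0 ≤ y)
    (hfx : d x (lam i) ≠ ⊤) (hfy : d y (lam i) ≠ ⊤) (hs : 0 ≤ s) (ht : 0 ≤ t) (hst : s + t = 1) :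
    (d (s * x + t * y) (lam i)).toReal ≤
      s * (d x (lam i)).toReal + t * (d y (lam i)).toReal := by
  have h1 := h.generator_convex i hx hy hs ht hst
  have hx' := ENNReal.mul_ne_top (ENNReal.ofReal_ne_top (r := s)) hfx
  have hy' := ENNReal.mul_ne_top (ENNReal.ofReal_ne_top (r := t)) hfy
  have h2 := ENNReal.toReal_mono (ENNReal.add_ne_top.2 ⟨hx', hy'⟩) h1
  rwa [ENNReal.toReal_add hx' hy', ENNReal.toReal_mul, ENNReal.toReal_mul,
    ENNReal.toReal_ofReal hs, ENNReal.toReal_ofReal ht] at h2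

theorem generator_self_ne_top (i : Fin p) : d (lam i) (lam i) ≠ ⊤ := by
  rw [h.generator_self i]; exact ENNReal.zero_ne_top

theorem generator_ne_top (i : Fin p) {a : ℝ} (ha : 0 < a) : d a (lam i) ≠ ⊤ :=
  h.spectral.finite _ (h.nonneg i) (h.generator_self_ne_top i) a ha

theorem isScalarGenerator (i : Fin p) :
    IsScalarGenerator (fun a => (d a (lam i)).toReal) (lam i) where
  nonneg_base := h.nonneg i
  convexOn := ⟨convex_Ioi 0, fun x hx y hy s t hs ht hst =>
    h.generator_toReal_convex i (le_of_lt hx) (le_of_lt hy) (h.generator_ne_top i hx)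
      (h.generator_ne_top i hy) hs ht hst⟩
  contDiffOn := (h.spectral.contDiffOn _ (h.nonneg i) (h.generator_self_ne_top i)).of_le
    (by norm_num)
  midpoint_le a ha := by
    have h1 := h.generator_toReal_convex i ha.le (h.nonneg i) (h.generator_ne_top i ha)
      (h.generator_self_ne_top i) (s := 1 / 2) (t := 1 / 2) (by norm_num) (by norm_num)
      (by norm_num)
    rw [h.generator_self i, ENNReal.toReal_zero, mul_zero, add_zero] at h1
    have e : (a + lam i) / 2 = 1 / 2 * a + 1 / 2 * lam i := by ring
    rw [e]
    linarith
  nonneg _ := ENNReal.toReal_nonneg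
  eq_base a ha h0 := by
    have h1 : d a (lam i) = 0 :=
      ((ENNReal.toReal_eq_zero_iff _).1 h0).resolve_right (h.generator_ne_top i ha)
    rw [h.generator_eq i ha.le] at h1
    have h2 := (h.divergence.eq_zero_iff _ _ (PosSemidef.diagonal (h.update_nonneg i ha.le))
      h.posSemidef_diagonal (h1.trans_ne ENNReal.zero_ne_top)).1 h1
    simpa using congrFun (diagonal_injective h2) i

/-- This extends the tangent inequality to `c = 0`, a possible diagonal entry of a competitor: use
the tangent at the midpoint of `a` and `c`, which is positive, then convexity. -/
theorem generator_tangent_le (i : Fin p) {a c : ℝ} (ha : 0 < a) (hc : 0 ≤ c)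
    (hfc : d c (lam i) ≠ ⊤) :
    (d a (lam i)).toReal + deriv (fun u => (d u (lam i)).toReal) a * (c - a) ≤
      (d c (lam i)).toReal := by
  have h1 := (h.isScalarGenerator i).tangent_le ha (c := 1 / 2 * c + 1 / 2 * a) (by positivity)
  have h2 := h.generator_toReal_convex i hc ha.le hfc (h.generator_ne_top i ha) (s := 1 / 2)
    (t := 1 / 2) (by norm_num) (by norm_num) (by norm_num)
  linarith

/-- Sign flips fix `diagonal lam`, so by equivariance they leave `D · (diagonal lam)` invariant;
averaging over them keeps a competitor in the sublevel set while removing its off-diagonal part. -/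
theorem sum_generator_diag_le {Z : Matrix (Fin p) (Fin p) ℝ} (hZ : Z.PosSemidef) {c : ℝ≥0∞}
    (hc : D Z (diagonal lam) ≤ c) : ∑ i, d (Z i i) (lam i) ≤ c := by
  rw [← h.spectral.spectral _ _ (fun i => hZ.diag_nonneg) h.nonneg]
  refine diagonal_diag_le_of_signFlip_invariant (Φ := fun X => D X (diagonal lam))
    (fun X Y hX hY hXc hYc => ?_) (fun X k hX => ?_) hZ hc
  · refine (h.convex_diagonal hX hY (by norm_num) (by norm_num) (by norm_num)).trans ?_
    calc _ ≤ ENNReal.ofReal (1 / 2) * c + ENNReal.ofReal (1 / 2) * c := by gcongr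
      _ = c := by
        rw [← add_mul, ← ENNReal.ofReal_add (by norm_num) (by norm_num)]
        norm_num
  · have hfix : signFlip k * diagonal lam * (signFlip k)ᵀ = diagonal lam := by
      ext i j
      rw [signFlip_conj_apply]
      by_cases hij : i = j
      · subst hij; split_ifs <;> simp
      · simp [hij]
    conv_lhs => rw [← hfix]
    exact (h.spectral.equivariant X _ (signFlip k) hX h.posSemidef_diagonal
      (signFlip_mem_orthogonalGroup k)).symm

/-- This is the first-order condition for a boundary point of the sublevel set: sum the tangent
inequalities at `φ`, where the total is exactly `ρ`, against the diagonal of `Z`, where it is at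
most `ρ`. -/
theorem sum_deriv_mul_nonpos {φ : Fin p → ℝ} {ρ : ℝ} (hφ : ∀ i, 0 < φ i)
    (hρ : ∑ i, (d (φ i) (lam i)).toReal = ρ) {Z : Matrix (Fin p) (Fin p) ℝ} (hZ : Z.PosSemidef)
    (hZρ : D Z (diagonal lam) ≤ ENNReal.ofReal ρ) :
    ∑ i, deriv (fun u => (d u (lam i)).toReal) (φ i) * (Z i i - φ i) ≤ 0 := by
  have h1 := h.sum_generator_diag_le hZ hZρ
  have hfin : ∀ i ∈ Finset.univ, d (Z i i) (lam i) ≠ ⊤ :=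
    ENNReal.sum_ne_top.1 (h1.trans_lt ENNReal.ofReal_lt_top).ne
  have hρ0 : 0 ≤ ρ := hρ ▸ Finset.sum_nonneg fun i _ => ENNReal.toReal_nonneg
  have h2 : ∑ i, (d (Z i i) (lam i)).toReal ≤ ρ := by
    rw [← ENNReal.toReal_sum hfin]
    exact ENNReal.toReal_le_of_le_ofReal hρ0 h1
  have h3 := Finset.sum_le_sum fun i hi =>
    h.generator_tangent_le i (hφ i) (hZ.diag_nonneg (i := i)) (hfin i hi)
  rw [Finset.sum_add_distrib, hρ] at h3
  linarith

theorem conj_diagonal_mem_uncertaintySet {φ : Fin p → ℝ} {ρ : ℝ} (hφ : ∀ i, 0 < φ i)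
    (hρ : ∑ i, d (φ i) (lam i) ≤ ENNReal.ofReal ρ) :
    V * diagonal φ * Vᵀ ∈ uncertaintySet D (V * diagonal lam * Vᵀ) ρ := by
  have hpsd : (diagonal φ).PosSemidef := (PosDef.diagonal hφ).posSemidef
  refine ⟨posSemidef_conj hpsd V, ?_⟩
  rwa [← h.divergence_conj hpsd, h.spectral.spectral _ _ (fun i => (hφ i).le) h.nonneg]

theorem isMaxOn_conj_diagonal {φ : Fin p → ℝ} {τ γ ρ : ℝ} (hγ : 0 ≤ γ)
    (hφ : ∀ i, IsEigenRoot d τ γ (lam i) (φ i))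
    (hρ : ∑ i, (d (φ i) (lam i)).toReal = ρ) :
    IsMaxOn (roObjective τ (V * diagonal φ * Vᵀ) (V * diagonal φ * Vᵀ)⁻¹)
      (uncertaintySet D (V * diagonal lam * Vᵀ) ρ) (V * diagonal φ * Vᵀ) := by
  intro S hS
  set Z := Vᵀ * S * V with hZdef
  have hVt := orthogonal_conj_cancel' h.orthogonal S
  have hZ : Z.PosSemidef := by
    simpa using posSemidef_conj hS.1 Vᵀ
  have hZρ : D Z (diagonal lam) ≤ ENNReal.ofReal ρ := by
    rw [h.divergence_conj hZ, hVt]; exact hS.2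
  have h1 := mul_nonpos_of_nonneg_of_nonpos hγ
    (h.sum_deriv_mul_nonpos (fun i => (hφ i).1) hρ hZ hZρ)
  have hroot : ∀ i, γ * deriv (fun u => (d u (lam i)).toReal) (φ i) = 1 / φ i - τ * φ i :=
    fun i => by linarith [(hφ i).2]
  -- The root equation replaces `γ` times the derivatives by the eigenvalues of `A⁻¹ - τ A`, so `h1`
  -- becomes the required comparison of affine functions of `S`.
  rw [Finset.mul_sum] at h1
  simp only [← mul_assoc, hroot] at h1
  have h2 : ∑ i, (1 / φ i - τ * φ i) * (Z i i - φ i) =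
      ∑ i, 1 / φ i * Z i i - ∑ i, 1 / φ i * φ i -
        τ * (∑ i, φ i * Z i i - ∑ i, φ i * φ i) := by
    simp only [Finset.mul_sum, ← Finset.sum_sub_distrib]
    exact Finset.sum_congr rfl fun i _ => by ring
  rw [h2] at h1
  change roObjective _ _ _ _ ≤ roObjective _ _ _ _
  unfold roObjective
  rw [inv_conj_diagonal h.orthogonal fun i => (hφ i).1.ne']
  simp only [frobInner_conj_diagonal, orthogonal_conj_cancel h.orthogonal, diagonal_apply_eq,
    ← hZdef]
  linarith

end IsSpectralSetting

end SpectralDivergence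

/-! ### Assembly of the main theorem. -/

theorem eigenMap_isEigenRoot {d : ℝ → ℝ → ℝ≥0∞} {τ γ b : ℝ}
    (h : ∃! a : ℝ, IsEigenRoot d τ γ b a) : IsEigenRoot d τ γ b (eigenMap d τ γ b) := by
  unfold eigenMap
  rw [dif_pos h.exists]
  exact h.exists.choose_spec

theorem theorem2 {p : ℕ}
    (D : Matrix (Fin p) (Fin p) ℝ → Matrix (Fin p) (Fin p) ℝ → ℝ≥0∞)
    (d : ℝ → ℝ → ℝ≥0∞)
    (Sn V : Matrix (Fin p) (Fin p) ℝ) (lam : Fin p → ℝ) (τ ρ : ℝ)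
    (hτ : 0 < τ)
    -- the nominal matrix and its spectral decomposition
    (hSn : Sn.PosSemidef)
    (hV : V ∈ orthogonalGroup (Fin p) ℝ)
    (hlam : Monotone lam)
    (hdec : Sn = V * diagonal lam * Vᵀ)
    -- the assumptions
    (hreg : D Sn Sn ≠ ⊤)
    (hconv : IsConvexDivergence D Sn)
    (hspec : IsSpectralDivergence D d)
    (hnid : ∀ σ : ℝ, 0 < σ → Sn ≠ σ • (1 : Matrix (Fin p) (Fin p) ℝ))
    (hρ : 0 < ρ)
    (hρmax : ENNReal.ofReal ρ ≤ ∑ i, d (√(1 / τ)) (lam i)) :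
    -- the eigenvalue mapping is well defined
    (∀ γ : ℝ, 0 ≤ γ → ∀ i, ∃! a : ℝ, IsEigenRoot d τ γ (lam i) a) ∧
    -- the inner maximum is attained
    (∀ Sg X : Matrix (Fin p) (Fin p) ℝ, RoFeasible Sg X →
      ∃ S ∈ uncertaintySet D Sn ρ, IsMaxOn (roObjective τ Sg X) (uncertaintySet D Sn ρ) S) ∧
    ∃ γs : ℝ,
      -- the unique nonnegative root
      (0 ≤ γs ∧ ∑ i, d (eigenMap d τ γs (lam i)) (lam i) = ENNReal.ofReal ρ) ∧
      (∀ γ : ℝ, 0 ≤ γ → ∑ i, d (eigenMap d τ γ (lam i)) (lam i) = ENNReal.ofReal ρ → γ = γs) ∧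
      -- the unique optimal solution
      IsRoSolution D Sn τ ρ
        (V * diagonal (fun i => eigenMap d τ γs (lam i)) * Vᵀ)
        (V * diagonal (fun i => eigenMap d τ γs (lam i)) * Vᵀ)⁻¹ ∧
      ∀ Sg X : Matrix (Fin p) (Fin p) ℝ, IsRoSolution D Sn τ ρ Sg X →
        Sg = V * diagonal (fun i => eigenMap d τ γs (lam i)) * Vᵀ ∧
        X = (V * diagonal (fun i => eigenMap d τ γs (lam i)) * Vᵀ)⁻¹ := by
  subst hdec
  have hnn : ∀ i, 0 ≤ lam i := by
    rw [← posSemidef_diagonal_iff, ← orthogonal_conj_cancel hV (diagonal lam)]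
    simpa using posSemidef_conj hSn Vᵀ
  have h : IsSpectralSetting D d V lam := ⟨hV, hnn, hreg, hconv, hspec⟩
  have hroot : ∀ γ : ℝ, 0 ≤ γ → ∀ i, ∃! a : ℝ, IsEigenRoot d τ γ (lam i) a :=
    fun γ hγ i => (h.isScalarGenerator i).existsUnique_root hτ hγ
  have hφ : ∀ i γ, 0 ≤ γ → IsEigenRoot d τ γ (lam i) (eigenMap d τ γ (lam i)) :=
    fun i γ hγ => eigenMap_isEigenRoot (hroot γ hγ i)
  have hτ' : 0 < √(1 / τ) := by positivity
  have hsum : ∀ x : Fin p → ℝ, (∀ i, 0 < x i) →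
      ∑ i, d (x i) (lam i) = ENNReal.ofReal (∑ i, (d (x i) (lam i)).toReal) := fun x hx => by
    rw [ENNReal.ofReal_sum_of_nonneg fun i _ => ENNReal.toReal_nonneg]
    exact Finset.sum_congr rfl fun i _ => (ENNReal.ofReal_toReal (h.generator_ne_top i (hx i))).symm
  -- One eigenvalue away from `√(1 / τ)` is what makes the total divergence strictly decreasing in
  -- `γ`.
  have hne : ∃ i, lam i ≠ √(1 / τ) := by
    by_contra! hall
    refine hnid _ hτ' ?_
    have : diagonal lam = √(1 / τ) • (1 : Matrix (Fin p) (Fin p) ℝ) := by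
      rw [smul_one_eq_diagonal]
      exact congrArg diagonal (funext hall)
    rw [this, mul_smul_comm, Matrix.mul_one, smul_mul_assoc, orthogonal_mul_transpose hV]
  have hρ' : ρ ≤ ∑ i, (d √(1 / τ) (lam i)).toReal := by
    rw [hsum _ fun _ => hτ'] at hρmax
    exact (ENNReal.ofReal_le_ofReal_iff (Finset.sum_nonneg fun i _ => ENNReal.toReal_nonneg)).1
      hρmax
  have hinj := sum_generator_injective h.isScalarGenerator hτ hne hφ
  have hval : ∀ γ, 0 ≤ γ → (∑ i, d (eigenMap d τ γ (lam i)) (lam i) = ENNReal.ofReal ρ ↔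
      ∑ i, (d (eigenMap d τ γ (lam i)) (lam i)).toReal = ρ) := fun γ hγ => by
    rw [hsum _ fun i => (hφ i γ hγ).1, ENNReal.ofReal_eq_ofReal_iff
      (Finset.sum_nonneg fun i _ => ENNReal.toReal_nonneg) hρ.le]
  obtain ⟨γs, hγs, hγsρ⟩ := exists_sum_generator_eq h.isScalarGenerator hτ hρ hρ' hφ
  have hγsρ' := (hval γs hγs).2 hγsρ
  have hpos : ∀ i, 0 < eigenMap d τ γs (lam i) := fun i => (hφ i γs hγs).1
  obtain ⟨hsol, huniq⟩ := isRoSolution_of_isMaxOn hτ (posDef_conj_diagonal hV hpos)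
    (h.conj_diagonal_mem_uncertaintySet hpos hγsρ'.le)
    (h.isMaxOn_conj_diagonal hγs (fun i => hφ i γs hγs) hγsρ)
  exact ⟨hroot, fun Sg X _ => hconv.exists_isMaxOn_roObjective hSn hreg τ ρ Sg X, γs,
    ⟨hγs, hγsρ'⟩, fun γ hγ e => hinj hγ hγs (((hval γ hγ).1 e).trans hγsρ.symm), hsol, huniq⟩
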